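/- Let $d, r \ge 0$ be integers. For an integrable $p$ on $\mathbb{R}^d$ put $\widehat p(s) = \int e^{-i s^\top x} p(x)\,dx$. A density $p$ is upper-supersmooth of order $\alpha$ with constants $C, C_1 > 0$ if $|\widehat p(s)| \le C \exp(-C_1 \sum_{j=1}^d |s_j|^{\alpha})$ for all $s \in \mathbb{R}^d$, and lower-supersmooth of order $\alpha$ with constants $c, C_2 > 0$ if $|\widehat p(s)| \ge c \exp(-C_2 \sum_{j=1}^d |s_j|^{\alpha})$ for all $s \in \mathbb{R}^d$. Let $\Theta \subseteq \mathbb{R}^d$ be a measurable set on which derivatives are well defined (it has unique differentials at each of its points, and every neighbourhood of every point of $\Theta$ meets $\Theta$ in positive measure; e.g. $\Theta$ open, or convex with nonempty interior). Let $0 < \alpha_1 \le \alpha_2$. Let $f$ be a probability density on $\mathbb{R}^d$ with $f(-x) = f(x)$ for all $x$, lower-supersmooth of order $\alpha_1$ with constants $c, C_2$. Let $g$ be a probability density on $\mathbb{R}^d$ vanishing outside $\Theta$, with $\|g\|_\infty < \infty$, upper-supersmooth of order $\alpha_2$ with constants $C, C_1$, and $g \in \mathcal{C}^r(\Theta)$,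 that is, on $\Theta$ the function $g$ has continuous, bounded and integrable derivatives up to order $r$. Let $n \ge 1$, let $X_1, \dots, X_n$ be i.i.d. with density $p_0(x) = \int_\Theta f(x - \theta) g(\theta)\,d\theta$, and for $\theta \in \mathbb{R}^d$ let $$\widehat g_{n,R}(\theta) = \frac{1}{n (2\pi)^d} \sum_{j=1}^n \int_{[-R,R]^d} \frac{\cos(s^\top(\theta - X_j))}{\widehat f(s)}\,ds .$$ Write $\nabla^i h$ for the tensor of all partial derivatives of order $i$ of $h$, $\|\cdot\|_{\max}$ for the maximum of the absolute values of its entries and $\|\cdot\|$ for the Euclidean norm of its entries. Then there are constants $C' > 0$, $C'_i$ and $\bar C_i$ ($1 \le i \le r$), depending only on $d, r, \alpha_1, \alpha_2, C, C_1, c, C_2$ (hence not on $n$, $R$, $\theta$), such that for all $R \ge C'$ and all $1 \le i \le r$ the estimator $\widehat g_{n,R}$ is $i$ times continuously differentiable, the expectations below exist, and $$\sup_{\theta \in \Theta} \bigl\| \mathbb{E}[\nabla^i \widehat g_{n,R}(\theta)] - \nabla^i g(\theta) \bigr\|_{\max} \le C'_i\, R^{\max\{i + 1 - \alpha_2,\,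 0\}} \exp(-C_1 R^{\alpha_2}),$$ $$\sup_{\theta \in \Theta} \mathbb{E}\Bigl[ \bigl\| \nabla^i \widehat g_{n,R}(\theta) - \mathbb{E}[\nabla^i \widehat g_{n,R}(\theta)] \bigr\|^2 \Bigr] \le \bar C_i\, \frac{R^{2(i+d)} \exp(2 C_2 d R^{\alpha_1})}{n}.$$ -/

import Mathlib

open MeasureTheory ProbabilityTheory Topology

noncomputable section

/-- A probability density function on `ℝ^d` (with respect to Lebesgue measure). -/
structure IsDensity {d : ℕ} (p : EuclideanSpace ℝ (Fin d) → ℝ) : Prop where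
  nonneg : ∀ x, 0 ≤ p x
  integrable : Integrable p volume
  integral_eq_one : ∫ x, p x = 1

/-- The Fourier transform `p̂(s) = ∫ exp(-i sᵀx) p(x) dx`. -/
def fourierHat {d : ℕ} (p : EuclideanSpace ℝ (Fin d) → ℝ) (s : EuclideanSpace ℝ (Fin d)) : ℂ :=
  ∫ x, Complex.exp (-(Complex.I * ((inner ℝ s x : ℝ) : ℂ))) * (p x : ℂ)

/-- `p` is upper-supersmooth of order `α` with associated constants `C` and `C₁`. -/
structure IsUpperSupersmooth {d : ℕ} (p : EuclideanSpace ℝ (Fin d) → ℝ) (α C C₁ : ℝ) : Prop where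
  const_pos : 0 < C
  rate_pos : 0 < C₁
  bound : ∀ s : EuclideanSpace ℝ (Fin d),
    ‖fourierHat p s‖ ≤ C * Real.exp (-(C₁ * ∑ j, |s j| ^ α))

/-- `p` is lower-supersmooth of order `α` with associated constants `c` and `C₂`. -/
structure IsLowerSupersmooth {d : ℕ} (p : EuclideanSpace ℝ (Fin d) → ℝ) (α c C₂ : ℝ) : Prop where
  const_pos : 0 < c
  rate_pos : 0 < C₂
  bound : ∀ s : EuclideanSpace ℝ (Fin d),
    c * Real.exp (-(C₂ * ∑ j, |s j| ^ α)) ≤ ‖fourierHat p s‖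

/-- The sets `Θ ⊆ ℝ^d` on which the derivatives of a function given on `Θ` only make sense, and
on which a continuous function is determined by its values almost everywhere. All open sets and
all convex sets with nonempty interior qualify. -/
structure IsParameterSet {d : ℕ} (Θ : Set (EuclideanSpace ℝ (Fin d))) : Prop where
  nullMeasurableSet : NullMeasurableSet Θ volume
  uniqueDiffOn : UniqueDiffOn ℝ Θ
  volume_ne_zero : ∀ θ ∈ Θ, ∀ U ∈ 𝓝 θ, volume (U ∩ Θ) ≠ 0

/-- The class `𝒞^r(Θ)`: the derivatives on `Θ` up to order `r` exist and are continuous, bounded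
and integrable on `Θ`. -/
structure IsBoundedIntegrableCr {d : ℕ} (r : ℕ) (Θ : Set (EuclideanSpace ℝ (Fin d)))
    (h : EuclideanSpace ℝ (Fin d) → ℝ) : Prop where
  contDiffOn : ContDiffOn ℝ (r : ℕ∞) h Θ
  bounded : ∀ k ≤ r, ∃ M : ℝ, ∀ θ ∈ Θ, ‖iteratedFDerivWithin ℝ k h Θ θ‖ ≤ M
  integrable : ∀ k ≤ r, IntegrableOn (iteratedFDerivWithin ℝ k h Θ) Θ volume

/-- The density `p₀(x) = ∫_Θ f(x - θ) g(θ) dθ` of the observations. -/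
def mixtureDensity {d : ℕ} (Θ : Set (EuclideanSpace ℝ (Fin d)))
    (f g : EuclideanSpace ℝ (Fin d) → ℝ) (x : EuclideanSpace ℝ (Fin d)) : ℝ :=
  ∫ θ in Θ, f (x - θ) * g θ

/-- The cube `[-R, R]^d`. -/
def cube (d : ℕ) (R : ℝ) : Set (EuclideanSpace ℝ (Fin d)) :=
  {s | ∀ j, s j ∈ Set.Icc (-R) R}

/-- The Fourier deconvolution estimator
`ĝ_{n,R}(θ) = (n (2π)^d)⁻¹ ∑ⱼ ∫_{[-R,R]^d} cos(sᵀ(θ - xⱼ)) / f̂(s) ds` computed from the sample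
`x₁, …, xₙ`. It is used for symmetric `f` only, for which `f̂` is real-valued. -/
def deconvEstimator {d n : ℕ} (f : EuclideanSpace ℝ (Fin d) → ℝ) (R : ℝ)
    (x : Fin n → EuclideanSpace ℝ (Fin d)) (θ : EuclideanSpace ℝ (Fin d)) : ℝ :=
  1 / ((n : ℝ) * (2 * Real.pi) ^ d) *
    ∑ j, ∫ s in cube d R, Real.cos (inner ℝ s (θ - x j)) / (fourierHat f s).re

/-- The tensor `∇^i h(θ) = (∂^i h / ∂θ_{u₁} ⋯ ∂θ_{uᵢ} (θ))_u` of the partial derivatives of order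
`i` of a function `h` on `S`, as an element of `ℝ^(d^i)` with the Euclidean norm. -/
def nablaWithin {d : ℕ} (i : ℕ) (S : Set (EuclideanSpace ℝ (Fin d)))
    (h : EuclideanSpace ℝ (Fin d) → ℝ) (θ : EuclideanSpace ℝ (Fin d)) :
    EuclideanSpace ℝ (Fin i → Fin d) :=
  WithLp.toLp 2 fun u =>
    iteratedFDerivWithin ℝ i h S θ fun k => EuclideanSpace.single (u k) (1 : ℝ)

/-- The tensor of the partial derivatives of order `i` of a function on the whole of `ℝ^d`. -/
def nabla {d : ℕ} (i : ℕ) (h : EuclideanSpace ℝ (Fin d) → ℝ) (θ : EuclideanSpace ℝ (Fin d)) :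
    EuclideanSpace ℝ (Fin i → Fin d) :=
  WithLp.toLp 2 fun u =>
    iteratedFDeriv ℝ i h θ fun k => EuclideanSpace.single (u k) (1 : ℝ)

/-- The maximum norm `‖T‖_max` of the entries. -/
def maxNorm {ι : Type*} [Fintype ι] (T : EuclideanSpace ℝ ι) : ℝ :=
  ⨆ u, |T u|

/-- `X₁, …, Xₙ` are independent random vectors with common density `p`. -/
structure IsIIDSample {Ω : Type*} [MeasurableSpace Ω] {d n : ℕ} (P : Measure Ω)
    (X : Fin n → Ω → EuclideanSpace ℝ (Fin d)) (p : EuclideanSpace ℝ (Fin d) → ℝ) : Prop where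
  aemeasurable : ∀ j, AEMeasurable (X j) P
  indep : iIndepFun X P
  law : ∀ j, P.map (X j) = volume.withDensity fun x => ENNReal.ofReal (p x)

end

/-!
The Fourier transform of the mixture density is `f̂ ĝ`, so multiplying by the truncated inverse
`1_{[-R,R]^d} / f̂` shows that the estimator has as its expectation the Fourier inversion integral
of `g` restricted to the cube, and the same holds for its derivatives, which only add the
multipliers `i^m ∏ₖ s_{uₖ}`. The bias is therefore the part of the inversion integral outside the
cube. There the largest coordinate of `s` exceeds `R` in absolute value and the multiplier is at
most its `m`-th power, which reduces the bound to one-dimensional incomplete gamma integrals. The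
variance of the mean of `n` independent terms is at most `n⁻¹` times the square of a bound for the
kernel, and on the cube `1 / f̂` is controlled by the lower supersmoothness of `f`.

Since `g` is only known to be continuous on `Θ`, its derivatives are computed from the inversion
integral: that is a smooth function which agrees with `g` almost everywhere, hence everywhere on
`Θ`.
-/

open scoped FourierTransform Real

section TrigonometricIntegral

variable {V : Type*} [NormedAddCommGroup V] [InnerProductSpace ℝ V]

variable (V) in
/-- The bilinear form that turns `VectorFourier.fourierIntegral` into `trigIntegral`: Mathlib's
Fourier transform has the kernel `exp(-2πi L(s, y))`, hence the factor `-(2π)⁻¹`. -/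
noncomputable def trigForm : V →L[ℝ] V →L[ℝ] ℝ :=
  (-(2 * π)⁻¹) • innerSL ℝ

lemma trigForm_apply (s y : V) : trigForm V s y = -(2 * π)⁻¹ * inner ℝ s y :=
  rfl

lemma fourierChar_neg_trigForm (s y : V) :
    ((𝐞 (-trigForm V s y) : Circle) : ℂ) = Complex.exp (Complex.I * (inner ℝ s y : ℝ)) := by
  have hπ : (π : ℂ) ≠ 0 := by exact_mod_cast Real.pi_ne_zero
  rw [Real.fourierChar_apply, trigForm_apply]
  congr 1
  push_cast
  field_simp

/-- The multiplier `i^n ∏ₖ sᵀvₖ`, by which the directional derivative `∂_{v₁} ⋯ ∂_{vₙ}` acts on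
the integrand of a trigonometric integral. -/
noncomputable def derivMultiplier {n : ℕ} (v : Fin n → V) (s : V) : ℂ :=
  Complex.I ^ n * (∏ k, inner ℝ s (v k) : ℝ)

lemma continuous_derivMultiplier {n : ℕ} (v : Fin n → V) : Continuous (derivMultiplier v) := by
  unfold derivMultiplier
  fun_prop

lemma norm_derivMultiplier {n : ℕ} (v : Fin n → V) (s : V) :
    ‖derivMultiplier v s‖ = ∏ k, |inner ℝ s (v k)| := by
  rw [derivMultiplier, norm_mul, norm_pow, Complex.norm_I, one_pow, one_mul, Complex.norm_real,
    norm_prod]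
  rfl

lemma norm_derivMultiplier_le {n : ℕ} (v : Fin n → V) (s : V) :
    ‖derivMultiplier v s‖ ≤ (∏ k, ‖v k‖) * ‖s‖ ^ n :=
  calc ‖derivMultiplier v s‖ = ∏ k, |inner ℝ s (v k)| := norm_derivMultiplier v s
    _ ≤ ∏ k, ‖v k‖ * ‖s‖ := by
        gcongr with k
        rw [mul_comm]
        exact abs_real_inner_le_norm s (v k)
    _ = (∏ k, ‖v k‖) * ‖s‖ ^ n := by
        rw [Finset.prod_mul_distrib, Finset.prod_const, Finset.card_univ, Fintype.card_fin]

variable [MeasurableSpace V] [BorelSpace V] [FiniteDimensional ℝ V]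

/-- The trigonometric integral `∫ exp(i sᵀy) h(s) ds`, that is, the inverse Fourier transform
normalised as in `fourierHat` and without the factor `(2π)^{-d}`. -/
noncomputable def trigIntegral (h : V → ℂ) (y : V) : ℂ :=
  ∫ s, Complex.exp (Complex.I * (inner ℝ s y : ℝ)) * h s

lemma trigIntegral_eq_fourierIntegral (h : V → ℂ) :
    trigIntegral h = VectorFourier.fourierIntegral 𝐞 volume (trigForm V).toLinearMap₁₂ h := by
  ext y
  refine integral_congr_ae (ae_of_all _ fun s => ?_)
  simp only [Circle.smul_def, smul_eq_mul, ← fourierChar_neg_trigForm,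
    ContinuousLinearMap.toLinearMap₁₂_apply_apply_apply]

lemma integrable_exp_inner_mul {h : V → ℂ} (hh : Integrable h) (y : V) :
    Integrable fun s => Complex.exp (Complex.I * (inner ℝ s y : ℝ)) * h s :=
  hh.bdd_mul (c := 1) (Continuous.aestronglyMeasurable (by fun_prop))
    (ae_of_all _ fun s => (Complex.norm_exp_I_mul_ofReal _).le)

lemma norm_trigIntegral_le (h : V → ℂ) (y : V) : ‖trigIntegral h y‖ ≤ ∫ s, ‖h s‖ := by
  refine (norm_integral_le_integral_norm _).trans_eq ?_
  simp_rw [norm_mul, Complex.norm_exp_I_mul_ofReal, one_mul]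

lemma continuous_trigIntegral {h : V → ℂ} (hh : Integrable h) : Continuous (trigIntegral h) := by
  refine continuous_of_dominated (bound := fun s => ‖h s‖)
    (fun y => (integrable_exp_inner_mul hh y).1) (fun y => ae_of_all _ fun s => ?_) hh.norm
    (ae_of_all _ fun s => by fun_prop)
  rw [norm_mul, Complex.norm_exp_I_mul_ofReal, one_mul]

lemma trigIntegral_indicator {S : Set V} (hS : MeasurableSet S) (h : V → ℂ) (y : V) :
    trigIntegral (S.indicator h) y =
      ∫ s in S, Complex.exp (Complex.I * (inner ℝ s y : ℝ)) * h s := by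
  rw [trigIntegral, ← integral_indicator hS]
  simp only [Set.indicator_mul_right]

lemma norm_trigIntegral_indicator_le {S : Set V} (hS : MeasurableSet S) (hS_fin : volume S < ⊤)
    {h : V → ℂ} {B : ℝ} (hB : ∀ s ∈ S, ‖h s‖ ≤ B) (y : V) :
    ‖trigIntegral (S.indicator h) y‖ ≤ B * volume.real S := by
  rw [trigIntegral_indicator hS]
  refine norm_setIntegral_le_of_norm_le_const hS_fin fun s hs => ?_
  rw [norm_mul, Complex.norm_exp_I_mul_ofReal, one_mul]
  exact hB s hs

lemma norm_trigIntegral_indicator_sub_le {S : Set V} (hS : MeasurableSet S) {h : V → ℂ}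
    (hh : Integrable h) (y : V) :
    ‖trigIntegral (S.indicator h) y - trigIntegral h y‖ ≤ ∫ s in Sᶜ, ‖h s‖ := by
  rw [trigIntegral_indicator hS, trigIntegral,
    ← integral_add_compl hS (integrable_exp_inner_mul hh y), sub_add_cancel_left, norm_neg]
  refine (norm_integral_le_integral_norm _).trans_eq ?_
  simp_rw [norm_mul, Complex.norm_exp_I_mul_ofReal, one_mul]

/-- `h` is measurable and has finite absolute moments up to order `n`, so that its trigonometric
integral is `n` times continuously differentiable. -/
structure HasMoments (h : V → ℂ) (n : ℕ) : Prop where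
  aestronglyMeasurable : AEStronglyMeasurable h
  integrable_norm_pow_mul : ∀ m ≤ n, Integrable fun s => ‖s‖ ^ m * ‖h s‖

namespace HasMoments

variable {h : V → ℂ} {n : ℕ}

lemma integrable (hh : HasMoments h n) : Integrable h := by
  rw [← integrable_norm_iff hh.aestronglyMeasurable]
  simpa only [pow_zero, one_mul] using hh.integrable_norm_pow_mul 0 n.zero_le

lemma integrable_derivMultiplier_mul (hh : HasMoments h n) (v : Fin n → V) :
    Integrable fun s => derivMultiplier v s * h s := by
  refine ((hh.integrable_norm_pow_mul n le_rfl).const_mul (∏ k, ‖v k‖)).mono'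
    ((continuous_derivMultiplier v).aestronglyMeasurable.mul hh.aestronglyMeasurable)
    (ae_of_all _ fun s => ?_)
  rw [norm_mul, ← mul_assoc]
  gcongr
  exact norm_derivMultiplier_le v s

lemma contDiff_trigIntegral (hh : HasMoments h n) : ContDiff ℝ n (trigIntegral h) := by
  rw [trigIntegral_eq_fourierIntegral]
  exact VectorFourier.contDiff_fourierIntegral (trigForm V) fun m hm =>
    hh.integrable_norm_pow_mul m (by exact_mod_cast hm)

lemma iteratedFDeriv_trigIntegral_apply (hh : HasMoments h n) (y : V) (v : Fin n → V) :
    iteratedFDeriv ℝ n (trigIntegral h) y v =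
      trigIntegral (fun s => derivMultiplier v s * h s) y := by
  have hπ : (π : ℂ) ≠ 0 := by exact_mod_cast Real.pi_ne_zero
  rw [trigIntegral_eq_fourierIntegral, trigIntegral_eq_fourierIntegral,
    VectorFourier.iteratedFDeriv_fourierIntegral (N := n) (trigForm V)
      (fun m hm => hh.integrable_norm_pow_mul m (by exact_mod_cast hm))
      hh.aestronglyMeasurable le_rfl,
    Real.fourierIntegral_continuousMultilinearMap_apply'
      (VectorFourier.integrable_fourierPowSMulRight _ (hh.integrable_norm_pow_mul n le_rfl)
        hh.aestronglyMeasurable)]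
  congr 1
  ext s
  simp only [VectorFourier.fourierPowSMulRight_apply, trigForm_apply, Finset.prod_mul_distrib,
    Finset.prod_const, Finset.card_univ, Fintype.card_fin, smul_eq_mul, Complex.real_smul,
    derivMultiplier]
  push_cast
  rw [← mul_assoc, ← mul_assoc, ← mul_pow]
  congr 3
  field_simp

lemma contDiff_re_trigIntegral (hh : HasMoments h n) :
    ContDiff ℝ n fun y => (trigIntegral h y).re :=
  Complex.reCLM.contDiff.comp hh.contDiff_trigIntegral

lemma iteratedFDeriv_re_trigIntegral_apply (hh : HasMoments h n) (y : V) (v : Fin n → V) :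
    iteratedFDeriv ℝ n (fun y => (trigIntegral h y).re) y v =
      (trigIntegral (fun s => derivMultiplier v s * h s) y).re := by
  rw [← hh.iteratedFDeriv_trigIntegral_apply]
  exact congrArg (fun T : V [×n]→L[ℝ] ℝ => T v)
    (Complex.reCLM.iteratedFDeriv_comp_left hh.contDiff_trigIntegral.contDiffAt le_rfl)

end HasMoments

lemma hasMoments_indicator_of_isCompact {K : Set V} (hK : IsCompact K) {h : V → ℂ}
    (hh : ContinuousOn h K) (n : ℕ) : HasMoments (K.indicator h) n where
  aestronglyMeasurable := (aestronglyMeasurable_indicator_iff hK.measurableSet).mpr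
    (hh.aestronglyMeasurable hK.measurableSet)
  integrable_norm_pow_mul m _ := by
    have hcont : ContinuousOn (fun s => ‖s‖ ^ m * ‖h s‖) K :=
      (continuous_norm.pow m).continuousOn.mul hh.norm
    have heq : (fun s => ‖s‖ ^ m * ‖K.indicator h s‖) = K.indicator fun s => ‖s‖ ^ m * ‖h s‖ :=
      funext fun s => by rw [norm_indicator_eq_indicator_norm, Set.indicator_mul_right]
    rw [heq]
    exact (hcont.integrableOn_compact hK).integrable_indicator hK.measurableSet

end TrigonometricIntegral

section FourierInversion

variable {V E : Type*} [NormedAddCommGroup V] [InnerProductSpace ℝ V] [FiniteDimensional ℝ V]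
  [MeasurableSpace V] [BorelSpace V] [NormedAddCommGroup E] [NormedSpace ℂ E]

lemma continuous_fourierInv {p : V → E} (hp : Integrable p) : Continuous (𝓕⁻ p) := by
  rw [Real.fourierInv_eq_fourier_comp_neg]
  exact VectorFourier.fourierIntegral_continuous Real.continuous_fourierChar continuous_inner
    hp.comp_neg

variable [CompleteSpace E]

lemma integral_fourier_smul_eq {a : V → ℂ} {b : V → E} (ha : Integrable a) (hb : Integrable b) :
    ∫ x, 𝓕 a x • b x = ∫ x, a x • 𝓕 b x := by
  have h := VectorFourier.integral_fourierIntegral_smul_eq_flip (μ := volume) (ν := volume)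
    (L := innerₗ V) Real.continuous_fourierChar continuous_inner ha hb
  rwa [flip_innerₗ] at h

lemma integral_smul_fourierInv_fourier (ψ : SchwartzMap V ℂ) {p : V → E} (hp : Integrable p)
    (hp' : Integrable (𝓕 p)) : ∫ x, ψ x • p x = ∫ x, ψ x • 𝓕⁻ (𝓕 p) x := by
  have hψ : Integrable (𝓕⁻ (ψ : V → ℂ)) := by
    rw [← SchwartzMap.fourierInv_coe]
    exact SchwartzMap.integrable _
  have hψ_inv : 𝓕 (𝓕⁻ (ψ : V → ℂ)) = ψ := by
    refine ψ.continuous.fourier_fourierInv_eq ψ.integrable ?_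
    rw [← SchwartzMap.fourier_coe]
    exact SchwartzMap.integrable _
  calc ∫ x, ψ x • p x = ∫ x, 𝓕 (𝓕⁻ (ψ : V → ℂ)) x • p x := by rw [hψ_inv]
    _ = ∫ x, 𝓕⁻ (ψ : V → ℂ) x • 𝓕 p x := integral_fourier_smul_eq hψ hp
    _ = ∫ x, 𝓕 (ψ : V → ℂ) (-x) • 𝓕 p x := by simp_rw [Real.fourierInv_eq_fourier_neg]
    _ = ∫ x, 𝓕 (ψ : V → ℂ) x • 𝓕 p (-x) := by
        rw [← integral_neg_eq_self]
        simp_rw [neg_neg]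
    _ = ∫ x, ψ x • 𝓕 (fun y => 𝓕 p (-y)) x := integral_fourier_smul_eq ψ.integrable hp'.comp_neg
    _ = ∫ x, ψ x • 𝓕⁻ (𝓕 p) x := by rw [Real.fourierInv_eq_fourier_comp_neg]

/- Mathlib inverts the Fourier transform at points of continuity; here the two sides are compared
as distributions. -/
theorem fourierInv_fourier_ae_eq {p : V → E} (hp : Integrable p) (hp' : Integrable (𝓕 p)) :
    p =ᵐ[volume] 𝓕⁻ (𝓕 p) := by
  refine ae_eq_of_integral_contDiff_smul_eq hp.locallyIntegrable
    (continuous_fourierInv hp').locallyIntegrable fun φ hφ hφc => ?_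
  have hψc : HasCompactSupport fun x => (φ x : ℂ) := hφc.comp_left Complex.ofReal_zero
  have hψ : ContDiff ℝ (⊤ : ℕ∞) fun x => (φ x : ℂ) := Complex.ofRealCLM.contDiff.comp hφ
  simpa only [HasCompactSupport.toSchwartzMap_toFun, Complex.coe_smul] using
    integral_smul_fourierInv_fourier (hψc.toSchwartzMap hψ) hp hp'

end FourierInversion

section FourierHat

variable {d : ℕ} {p : EuclideanSpace ℝ (Fin d) → ℝ}

lemma fourierHat_two_pi_smul (p : EuclideanSpace ℝ (Fin d) → ℝ) (s : EuclideanSpace ℝ (Fin d)) :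
    fourierHat p ((2 * π) • s) = 𝓕 (fun x => (p x : ℂ)) s := by
  rw [Real.fourier_eq']
  refine integral_congr_ae (ae_of_all _ fun x => ?_)
  simp only [inner_smul_left, real_inner_comm x s, smul_eq_mul, conj_trivial]
  push_cast
  ring_nf

lemma fourierInv_comp_two_pi_smul (h : EuclideanSpace ℝ (Fin d) → ℂ)
    (x : EuclideanSpace ℝ (Fin d)) :
    𝓕⁻ (fun s => h ((2 * π) • s)) x = (((2 * π) ^ d)⁻¹ : ℝ) * trigIntegral h x := by
  have hscale := Measure.integral_comp_smul (volume : Measure (EuclideanSpace ℝ (Fin d)))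
    (fun s => Complex.exp (Complex.I * (inner ℝ s x : ℝ)) * h s) (2 * π)
  rw [finrank_euclideanSpace_fin, abs_of_pos (by positivity), Complex.real_smul] at hscale
  rw [trigIntegral, ← hscale, Real.fourierInv_eq']
  refine integral_congr_ae (ae_of_all _ fun s => ?_)
  simp only [inner_smul_left, smul_eq_mul, conj_trivial]
  push_cast
  ring_nf

lemma fourierHat_eq_trigIntegral (p : EuclideanSpace ℝ (Fin d) → ℝ) :
    fourierHat p = fun s => trigIntegral (fun x => (p x : ℂ)) (-s) := by
  ext s
  simp only [fourierHat, trigIntegral, inner_neg_right, real_inner_comm s, Complex.ofReal_neg,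
    mul_neg]

lemma continuous_fourierHat (hp : Integrable p) : Continuous (fourierHat p) := by
  rw [fourierHat_eq_trigIntegral]
  exact (continuous_trigIntegral hp.ofReal).comp continuous_neg

theorem ae_eq_trigIntegral_fourierHat (hp : Integrable p) (hp' : Integrable (fourierHat p)) :
    (fun x => (p x : ℂ)) =ᵐ[volume]
      fun x => (((2 * π) ^ d)⁻¹ : ℝ) * trigIntegral (fourierHat p) x := by
  have hfourier : 𝓕 (fun x => (p x : ℂ)) = fun s => fourierHat p ((2 * π) • s) :=
    funext fun s => (fourierHat_two_pi_smul p s).symm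
  have h_int : Integrable (𝓕 fun x => (p x : ℂ)) := by
    rw [hfourier]
    exact hp'.comp_smul (by positivity)
  filter_upwards [fourierInv_fourier_ae_eq hp.ofReal h_int] with x hx
  rw [← fourierInv_comp_two_pi_smul, ← hfourier]
  exact hx

/-- The real part of the inverse Fourier transform, normalised as in `fourierHat`. It recovers a
real function from its Fourier transform, and the estimator averages translates of it. -/
noncomputable def reFourierInv (h : EuclideanSpace ℝ (Fin d) → ℂ) (y : EuclideanSpace ℝ (Fin d)) :
    ℝ :=
  ((2 * π) ^ d)⁻¹ * (trigIntegral h y).re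

lemma ae_eq_reFourierInv_fourierHat (hp : Integrable p) (hp' : Integrable (fourierHat p)) :
    p =ᵐ[volume] reFourierInv (fourierHat p) := by
  filter_upwards [ae_eq_trigIntegral_fourierHat hp hp'] with x hx
  simpa only [reFourierInv, Complex.ofReal_re, Complex.re_ofReal_mul] using congrArg Complex.re hx

end FourierHat

section ReFourierInv

variable {d n : ℕ} {h : EuclideanSpace ℝ (Fin d) → ℂ}

lemma continuous_reFourierInv (hh : Integrable h) : Continuous (reFourierInv h) :=
  (Complex.continuous_re.comp (continuous_trigIntegral hh)).const_mul _

lemma abs_reFourierInv_le (h : EuclideanSpace ℝ (Fin d) → ℂ) (y : EuclideanSpace ℝ (Fin d)) :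
    |reFourierInv h y| ≤ ((2 * π) ^ d)⁻¹ * ‖trigIntegral h y‖ := by
  rw [reFourierInv, abs_mul, abs_of_pos (by positivity)]
  gcongr
  exact Complex.abs_re_le_norm _

lemma abs_reFourierInv_le_integral_norm (h : EuclideanSpace ℝ (Fin d) → ℂ)
    (y : EuclideanSpace ℝ (Fin d)) :
    |reFourierInv h y| ≤ ((2 * π) ^ d)⁻¹ * ∫ s, ‖h s‖ :=
  (abs_reFourierInv_le h y).trans (by gcongr; exact norm_trigIntegral_le h y)

lemma abs_reFourierInv_sub_le (h k : EuclideanSpace ℝ (Fin d) → ℂ)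
    (y : EuclideanSpace ℝ (Fin d)) :
    |reFourierInv h y - reFourierInv k y| ≤
      ((2 * π) ^ d)⁻¹ * ‖trigIntegral h y - trigIntegral k y‖ := by
  rw [reFourierInv, reFourierInv, ← mul_sub, abs_mul, abs_of_pos (by positivity), ← Complex.sub_re]
  gcongr
  exact Complex.abs_re_le_norm _

/-- The multiplier `i^n ∏ₖ s_{uₖ}` of the partial derivative `∂_{u₁} ⋯ ∂_{uₙ}`. -/
noncomputable def partialMultiplier (u : Fin n → Fin d) : EuclideanSpace ℝ (Fin d) → ℂ :=
  derivMultiplier fun k => EuclideanSpace.single (u k) (1 : ℝ)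

lemma norm_partialMultiplier (u : Fin n → Fin d) (s : EuclideanSpace ℝ (Fin d)) :
    ‖partialMultiplier u s‖ = ∏ k, |s (u k)| := by
  simp only [partialMultiplier, norm_derivMultiplier, EuclideanSpace.inner_single_right, one_mul,
    conj_trivial]

lemma HasMoments.integrable_partialMultiplier_mul (hh : HasMoments h n) (u : Fin n → Fin d) :
    Integrable fun s => partialMultiplier u s * h s :=
  hh.integrable_derivMultiplier_mul _

lemma HasMoments.contDiff_reFourierInv (hh : HasMoments h n) : ContDiff ℝ n (reFourierInv h) :=
  contDiff_const.mul hh.contDiff_re_trigIntegral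

lemma HasMoments.nabla_reFourierInv_apply (hh : HasMoments h n) (y : EuclideanSpace ℝ (Fin d))
    (u : Fin n → Fin d) :
    nabla n (reFourierInv h) y u = reFourierInv (fun s => partialMultiplier u s * h s) y := by
  change iteratedFDeriv ℝ n (((2 * π) ^ d)⁻¹ • fun y => (trigIntegral h y).re) y _ = _
  rw [iteratedFDeriv_const_smul_apply hh.contDiff_re_trigIntegral.contDiffAt, smul_apply,
    hh.iteratedFDeriv_re_trigIntegral_apply]
  rfl

end ReFourierInv

section TailIntegrals

variable {α C R q s : ℝ}

lemma integrableOn_Ioi_rpow_mul_exp_neg_mul_rpow (hs : -1 < s) (hα : 0 < α) (hC : 0 < C) :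
    IntegrableOn (fun t : ℝ => t ^ s * Real.exp (-(C * t ^ α))) (Set.Ioi 0) := by
  simpa only [neg_mul] using integrableOn_rpow_mul_exp_neg_mul_rpow hs hα hC

lemma integrableOn_Ioi_one_add_rpow_mul_exp_neg (hC : 0 < C) (hq : 0 ≤ q) :
    IntegrableOn (fun y : ℝ => (1 + y) ^ q * Real.exp (-(C * y))) (Set.Ioi 0) := by
  have htail : IntegrableOn (fun y : ℝ => y ^ q * Real.exp (-(C * y))) (Set.Ioi 1) := by
    simpa only [Real.rpow_one] using (integrableOn_Ioi_rpow_mul_exp_neg_mul_rpow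
      (by linarith) one_pos hC).mono_set (Set.Ioi_subset_Ioi zero_le_one)
  have hshift := ((measurePreserving_add_left volume (1 : ℝ)).integrableOn_comp_preimage
    (measurableEmbedding_addLeft 1)).mpr htail
  rw [Set.preimage_const_add_Ioi, sub_self] at hshift
  refine (hshift.const_mul (Real.exp C)).congr (ae_of_all _ fun y => ?_)
  simp only [Function.comp_apply]
  rw [mul_left_comm, ← Real.exp_add]
  ring_nf

/- After the shift `y ↦ ρ + y` the power factors as `(ρ + y) ^ q = ρ ^ q * (1 + y / ρ) ^ q`, where
`1 ≤ 1 + y / ρ ≤ 1 + y`. -/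
lemma integral_Ioi_rpow_mul_exp_neg_le {ρ : ℝ} (hC : 0 < C) (hρ : 1 ≤ ρ) :
    ∫ y in Set.Ioi ρ, y ^ q * Real.exp (-(C * y)) ≤
      (∫ y in Set.Ioi 0, (1 + y) ^ max q 0 * Real.exp (-(C * y))) *
        (ρ ^ q * Real.exp (-(C * ρ))) := by
  have hρ0 : 0 < ρ := one_pos.trans_le hρ
  have hshift := (measurePreserving_add_left volume ρ).setIntegral_preimage_emb
    (measurableEmbedding_addLeft ρ) (fun y => y ^ q * Real.exp (-(C * y))) (Set.Ioi ρ)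
  rw [Set.preimage_const_add_Ioi, sub_self] at hshift
  rw [← hshift, ← integral_mul_const]
  refine integral_mono_of_nonneg
    ((ae_restrict_mem measurableSet_Ioi).mono fun y (hy : 0 < y) => by
      change 0 ≤ (ρ + y) ^ q * _
      positivity)
    ((integrableOn_Ioi_one_add_rpow_mul_exp_neg hC (le_max_right q 0)).mul_const _)
    ((ae_restrict_mem measurableSet_Ioi).mono fun y (hy : 0 < y) => ?_)
  have hpow : (ρ + y) ^ q ≤ ρ ^ q * (1 + y) ^ max q 0 :=
    calc (ρ + y) ^ q = ρ ^ q * (1 + y / ρ) ^ q := by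
          rw [← Real.mul_rpow hρ0.le (by positivity), mul_add, mul_one, mul_div_cancel₀ _ hρ0.ne']
      _ ≤ ρ ^ q * (1 + y / ρ) ^ max q 0 := by
          gcongr
          exacts [le_add_of_nonneg_right (by positivity), le_max_left q 0]
      _ ≤ ρ ^ q * (1 + y) ^ max q 0 := by
          gcongr
          exact div_le_self hy.le hρ
  calc (ρ + y) ^ q * Real.exp (-(C * (ρ + y)))
      ≤ (ρ ^ q * (1 + y) ^ max q 0) * Real.exp (-(C * (ρ + y))) := by gcongr
    _ = (1 + y) ^ max q 0 * Real.exp (-(C * y)) * (ρ ^ q * Real.exp (-(C * ρ))) := by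
        rw [mul_add, neg_add, Real.exp_add]
        ring

lemma integral_Ioi_rpow_mul_exp_neg_mul_rpow (hα : 0 < α) (hR : 0 ≤ R) :
    ∫ t in Set.Ioi R, t ^ s * Real.exp (-(C * t ^ α)) =
      α⁻¹ * ∫ y in Set.Ioi (R ^ α), y ^ ((s + 1) / α - 1) * Real.exp (-(C * y)) := by
  rw [← integral_const_mul, ← integral_comp_rpow_Ioi_of_pos' hα (Real.rpow_nonneg hR α),
    Real.rpow_rpow_inv hR hα.ne']
  refine setIntegral_congr_fun measurableSet_Ioi fun t ht => ?_
  have ht0 : 0 < t := hR.trans_lt ht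
  have hpow : t ^ s = t ^ (α - 1) * (t ^ α) ^ ((s + 1) / α - 1) := by
    rw [← Real.rpow_mul ht0.le, ← Real.rpow_add ht0]
    congr 1
    field_simp
    ring
  simp only [smul_eq_mul]
  rw [hpow]
  field_simp

/-- The constant in the bound for the upper tail of `t ↦ t ^ s * exp (-C * t ^ α)`, which is an
incomplete gamma integral. -/
noncomputable def expTailConst (C α s : ℝ) : ℝ :=
  α⁻¹ * ∫ y in Set.Ioi 0, (1 + y) ^ max ((s + 1) / α - 1) 0 * Real.exp (-(C * y))

lemma expTailConst_nonneg (hα : 0 < α) (C s : ℝ) : 0 ≤ expTailConst C α s :=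
  mul_nonneg (by positivity) (setIntegral_nonneg measurableSet_Ioi fun y (hy : 0 < y) => by
    positivity)

lemma integral_Ioi_rpow_mul_exp_neg_mul_rpow_le (hα : 0 < α) (hC : 0 < C) (hR : 1 ≤ R) :
    ∫ t in Set.Ioi R, t ^ s * Real.exp (-(C * t ^ α)) ≤
      expTailConst C α s * (R ^ (s + 1 - α) * Real.exp (-(C * R ^ α))) := by
  have hR0 : 0 ≤ R := zero_le_one.trans hR
  have hexponent : α * ((s + 1) / α - 1) = s + 1 - α := by field_simp
  rw [integral_Ioi_rpow_mul_exp_neg_mul_rpow hα hR0, expTailConst, mul_assoc, ← hexponent,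
    Real.rpow_mul hR0]
  gcongr
  exact integral_Ioi_rpow_mul_exp_neg_le hC (Real.one_le_rpow hR hα.le)

lemma integrable_comp_abs {E : Type*} [NormedAddCommGroup E] {φ : ℝ → E}
    (hφ : IntegrableOn φ (Set.Ioi 0)) : Integrable fun t => φ |t| := by
  have hpos := hφ.integrable_indicator measurableSet_Ioi
  refine (hpos.add hpos.comp_neg).congr ((Measure.ae_ne volume 0).mono fun t ht => ?_)
  rcases ht.lt_or_gt with ht | ht
  · simp [ht, ht.le, abs_of_neg]
  · simp [ht, ht.le, abs_of_pos]

lemma integrable_abs_pow_mul_exp_neg (hα : 0 < α) (hC : 0 < C) (i : ℕ) :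
    Integrable fun t : ℝ => |t| ^ i * Real.exp (-(C * |t| ^ α)) := by
  refine integrable_comp_abs (φ := fun t => t ^ i * Real.exp (-(C * t ^ α))) ?_
  simpa only [Real.rpow_natCast] using integrableOn_Ioi_rpow_mul_exp_neg_mul_rpow
    (s := i) (neg_one_lt_zero.trans_le i.cast_nonneg) hα hC

lemma integrable_exp_neg_mul_abs_rpow (hα : 0 < α) (hC : 0 < C) :
    Integrable fun t : ℝ => Real.exp (-(C * |t| ^ α)) := by
  simpa only [pow_zero, one_mul] using integrable_abs_pow_mul_exp_neg hα hC 0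

lemma integrable_one_add_abs_pow_mul_exp_neg (hα : 0 < α) (hC : 0 < C) (n : ℕ) :
    Integrable fun t : ℝ => (1 + |t|) ^ n * Real.exp (-(C * |t| ^ α)) := by
  simp_rw [add_comm (1 : ℝ), add_pow, one_pow, mul_one, mul_comm (_ ^ _) (Nat.cast _),
    Finset.sum_mul, mul_assoc]
  exact integrable_finsetSum _ fun m _ => (integrable_abs_pow_mul_exp_neg hα hC m).const_mul _

lemma integral_indicator_lt_abs_le (hα : 0 < α) (hC : 0 < C) (hR : 1 ≤ R) (i : ℕ) :
    ∫ t, {t : ℝ | R < |t|}.indicator (fun t => |t| ^ i * Real.exp (-(C * |t| ^ α))) t ≤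
      2 * expTailConst C α i * (R ^ ((i : ℝ) + 1 - α) * Real.exp (-(C * R ^ α))) := by
  have hR0 : 0 ≤ R := zero_le_one.trans hR
  calc ∫ t, {t : ℝ | R < |t|}.indicator (fun t => |t| ^ i * Real.exp (-(C * |t| ^ α))) t
      = ∫ t, (Set.Ioi R).indicator (fun t => t ^ (i : ℝ) * Real.exp (-(C * t ^ α))) |t| := by
        simp only [Set.indicator, Set.mem_ofPred_eq, Set.mem_Ioi, Real.rpow_natCast]
    _ = 2 * ∫ t in Set.Ioi R, t ^ (i : ℝ) * Real.exp (-(C * t ^ α)) := by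
        rw [integral_comp_abs (f := (Set.Ioi R).indicator _), setIntegral_indicator
          measurableSet_Ioi, Set.Ioi_inter_Ioi, sup_of_le_right hR0]
    _ ≤ _ := by
        rw [mul_assoc]
        gcongr
        exact integral_Ioi_rpow_mul_exp_neg_mul_rpow_le hα hC hR

end TailIntegrals

section ProductIntegrals

variable {ι : Type*} [Fintype ι]

lemma integrable_euclidean_prod {φ : ι → ℝ → ℝ} (hφ : ∀ j, Integrable (φ j)) :
    Integrable fun s : EuclideanSpace ℝ ι => ∏ j, φ j (s j) :=
  (PiLp.volume_preserving_ofLp ι).integrable_comp_of_integrable (Integrable.fintype_prod hφ)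

lemma integral_euclidean_prod (φ : ι → ℝ → ℝ) :
    ∫ s : EuclideanSpace ℝ ι, ∏ j, φ j (s j) = ∏ j, ∫ t, φ j t := by
  rw [← integral_fintype_prod_volume_eq_prod]
  exact (PiLp.volume_preserving_ofLp ι).integral_comp
    (MeasurableEquiv.toLp 2 (ι → ℝ)).symm.measurableEmbedding fun x => ∏ j, φ j (x j)

lemma mul_prod_eq_prod_update [DecidableEq ι] (φ E : ℝ → ℝ) (l : ι) (s : ι → ℝ) :
    φ (s l) * ∏ j, E (s j) =
      ∏ j, Function.update (fun _ => E) l (fun t => φ t * E t) j (s j) := by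
  simp_rw [Function.apply_update (fun j (ψ : ℝ → ℝ) => ψ (s j))]
  rw [Finset.prod_update_of_mem (Finset.mem_univ l), mul_assoc,
    ← Finset.prod_eq_mul_prod_sdiff_singleton_of_mem (Finset.mem_univ l) fun j => E (s j)]

variable {φ E : ℝ → ℝ}

lemma integrable_mul_euclidean_prod (hφE : Integrable fun t => φ t * E t) (hE : Integrable E)
    (l : ι) : Integrable fun s : EuclideanSpace ℝ ι => φ (s l) * ∏ j, E (s j) := by
  classical
  simp_rw [mul_prod_eq_prod_update φ E l]
  refine integrable_euclidean_prod fun j => ?_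
  rcases eq_or_ne j l with rfl | hj
  · simpa only [Function.update_self] using hφE
  · simpa only [Function.update_of_ne hj] using hE

lemma integral_mul_euclidean_prod (φ E : ℝ → ℝ) (l : ι) :
    ∫ s : EuclideanSpace ℝ ι, φ (s l) * ∏ j, E (s j) =
      (∫ t, φ t * E t) * (∫ t, E t) ^ (Fintype.card ι - 1) := by
  classical
  simp_rw [mul_prod_eq_prod_update φ E l]
  rw [integral_euclidean_prod]
  simp_rw [Function.apply_update (fun _ (ψ : ℝ → ℝ) => ∫ t, ψ t)]
  rw [Finset.prod_update_of_mem (Finset.mem_univ l), Finset.prod_const,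
    Finset.card_sdiff_of_subset (Finset.subset_univ _), Finset.card_singleton, Finset.card_univ]

lemma one_add_sum_le_prod_one_add {κ : Type*} (S : Finset κ) {a : κ → ℝ} (ha : ∀ j, 0 ≤ a j) :
    1 + ∑ j ∈ S, a j ≤ ∏ j ∈ S, (1 + a j) := by
  classical
  induction S using Finset.induction_on with
  | empty => simp
  | insert j S hj ih =>
    rw [Finset.sum_insert hj, Finset.prod_insert hj]
    have hsum : 0 ≤ ∑ j ∈ S, a j := Finset.sum_nonneg fun j _ => ha j
    nlinarith [mul_nonneg (ha j) hsum, mul_le_mul_of_nonneg_left ih (ha j)]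

lemma norm_le_prod_one_add_abs (s : EuclideanSpace ℝ ι) : ‖s‖ ≤ ∏ j, (1 + |s j|) :=
  calc ‖s‖ ≤ ∑ j, |s j| := by
        rw [EuclideanSpace.norm_eq, Real.sqrt_le_left (by positivity)]
        exact Finset.sum_sq_le_sq_sum_of_nonneg fun j _ => abs_nonneg (s j)
    _ ≤ 1 + ∑ j, |s j| := le_add_of_nonneg_left zero_le_one
    _ ≤ ∏ j, (1 + |s j|) := one_add_sum_le_prod_one_add Finset.univ fun j => abs_nonneg (s j)

lemma exp_neg_mul_sum_abs_rpow (C α : ℝ) (s : ι → ℝ) :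
    Real.exp (-(C * ∑ j, |s j| ^ α)) = ∏ j, Real.exp (-(C * |s j| ^ α)) := by
  rw [← Real.exp_sum, Finset.sum_neg_distrib, Finset.mul_sum]

lemma integrable_norm_pow_mul_exp_neg {α C : ℝ} (hα : 0 < α) (hC : 0 < C) (n : ℕ) :
    Integrable fun s : EuclideanSpace ℝ ι => ‖s‖ ^ n * Real.exp (-(C * ∑ j, |s j| ^ α)) := by
  refine (integrable_euclidean_prod (ι := ι) fun _ =>
    integrable_one_add_abs_pow_mul_exp_neg hα hC n).mono'
    (Measurable.aestronglyMeasurable (by fun_prop)) (ae_of_all _ fun s => ?_)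
  rw [Real.norm_of_nonneg (by positivity), Finset.prod_mul_distrib, Finset.prod_pow,
    exp_neg_mul_sum_abs_rpow]
  gcongr
  exact norm_le_prod_one_add_abs s

end ProductIntegrals

section Cube

variable {d i : ℕ} {R : ℝ}

lemma cube_eq_preimage (d : ℕ) (R : ℝ) :
    cube d R = WithLp.ofLp ⁻¹' Set.univ.pi fun _ => Set.Icc (-R) R := by
  ext s
  simp only [cube, Set.mem_ofPred_eq, Set.mem_preimage, Set.mem_univ_pi]

lemma isCompact_cube (d : ℕ) (R : ℝ) : IsCompact (cube d R) := by
  rw [cube_eq_preimage]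
  exact (EuclideanSpace.equiv (Fin d) ℝ).toHomeomorph.isCompact_preimage.mpr
    (isCompact_univ_pi fun _ => isCompact_Icc)

lemma measurableSet_cube (d : ℕ) (R : ℝ) : MeasurableSet (cube d R) :=
  (isCompact_cube d R).measurableSet

lemma volume_real_cube (d : ℕ) (hR : 0 ≤ R) : volume.real (cube d R) = (2 * R) ^ d := by
  rw [measureReal_def, cube_eq_preimage, (PiLp.volume_preserving_ofLp (Fin d)).measure_preimage
    (MeasurableSet.univ_pi fun _ => measurableSet_Icc).nullMeasurableSet, volume_pi_pi,
    ENNReal.toReal_prod]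
  simp only [Real.volume_Icc, sub_neg_eq_add, ← two_mul, Finset.prod_const, Finset.card_univ,
    Fintype.card_fin, ENNReal.toReal_ofReal (mul_nonneg zero_le_two hR)]

lemma prod_abs_apply_le (u : Fin i → Fin d) {s : EuclideanSpace ℝ (Fin d)} {b : ℝ}
    (hs : ∀ j, |s j| ≤ b) : ∏ k, |s (u k)| ≤ b ^ i :=
  calc ∏ k, |s (u k)| ≤ ∏ _k : Fin i, b :=
        Finset.prod_le_prod (fun k _ => abs_nonneg _) fun k _ => hs (u k)
    _ = b ^ i := by rw [Finset.prod_const, Finset.card_univ, Fintype.card_fin]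

lemma integrable_prod_abs_mul_exp_neg (u : Fin i → Fin d) {α C : ℝ} (hα : 0 < α) (hC : 0 < C) :
    Integrable fun s : EuclideanSpace ℝ (Fin d) =>
      (∏ k, |s (u k)|) * Real.exp (-(C * ∑ j, |s j| ^ α)) := by
  refine (integrable_norm_pow_mul_exp_neg hα hC i).mono'
    (Measurable.aestronglyMeasurable (by fun_prop)) (ae_of_all _ fun s => ?_)
  rw [Real.norm_of_nonneg (by positivity)]
  gcongr
  exact prod_abs_apply_le u (PiLp.norm_apply_le s)

lemma prod_abs_le_sum_indicator (u : Fin i → Fin d) {s : EuclideanSpace ℝ (Fin d)}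
    (hs : s ∉ cube d R) :
    ∏ k, |s (u k)| ≤ ∑ l, {t : ℝ | R < |t|}.indicator (fun t => |t| ^ i) (s l) := by
  obtain ⟨j, hj⟩ : ∃ j, R < |s j| := by
    by_contra! h
    exact hs fun j => abs_le.mp (h j)
  obtain ⟨l, -, hmax⟩ := Finset.exists_max_image Finset.univ (fun j => |s j|) ⟨j, Finset.mem_univ j⟩
  calc ∏ k, |s (u k)| ≤ |s l| ^ i := prod_abs_apply_le u fun j => hmax j (Finset.mem_univ j)
    _ = {t : ℝ | R < |t|}.indicator (fun t => |t| ^ i) (s l) :=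
        (Set.indicator_of_mem (hj.trans_le (hmax j (Finset.mem_univ j))) _).symm
    _ ≤ _ := Finset.single_le_sum
        (f := fun l => {t : ℝ | R < |t|}.indicator (fun t => |t| ^ i) (s l))
        (fun l _ => Set.indicator_nonneg (fun t _ => by positivity) _) (Finset.mem_univ l)

lemma setIntegral_compl_cube_prod_le (u : Fin i → Fin d) {E : ℝ → ℝ} (hE_nonneg : ∀ t, 0 ≤ E t)
    (hE : Integrable E) (hiE : Integrable fun t => |t| ^ i * E t) :
    ∫ s in (cube d R)ᶜ, (∏ k, |s (u k)|) * ∏ j, E (s j) ≤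
      d * (∫ t, E t) ^ (d - 1) * ∫ t, {t : ℝ | R < |t|}.indicator (fun t => |t| ^ i * E t) t := by
  let φ : ℝ → ℝ := {t : ℝ | R < |t|}.indicator fun t => |t| ^ i
  have hφ_nonneg : ∀ t, 0 ≤ φ t := Set.indicator_nonneg fun t _ => by positivity
  have hφE : (fun t => φ t * E t) = {t : ℝ | R < |t|}.indicator fun t => |t| ^ i * E t :=
    funext fun t => (Set.indicator_mul_left _ _ _).symm
  have hφE_int : Integrable fun t => φ t * E t := by
    rw [hφE]
    exact hiE.indicator (measurableSet_lt measurable_const (by fun_prop))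
  have h_int : ∀ l, Integrable fun s : EuclideanSpace ℝ (Fin d) => φ (s l) * ∏ j, E (s j) :=
    fun l => integrable_mul_euclidean_prod hφE_int hE l
  have hE_prod : ∀ s : EuclideanSpace ℝ (Fin d), 0 ≤ ∏ j, E (s j) :=
    fun s => Finset.prod_nonneg fun j _ => hE_nonneg _
  calc ∫ s in (cube d R)ᶜ, (∏ k, |s (u k)|) * ∏ j, E (s j)
      ≤ ∫ s in (cube d R)ᶜ, ∑ l, φ (s l) * ∏ j, E (s j) := by
        refine integral_mono_of_nonneg (ae_of_all _ fun s => mul_nonneg (by positivity) (hE_prod s))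
          (integrable_finsetSum _ fun l _ => h_int l).integrableOn
          ((ae_restrict_mem (measurableSet_cube d R).compl).mono fun s hs => ?_)
        simp only [← Finset.sum_mul]
        exact mul_le_mul_of_nonneg_right (prod_abs_le_sum_indicator u hs) (hE_prod s)
    _ ≤ ∫ s : EuclideanSpace ℝ (Fin d), ∑ l, φ (s l) * ∏ j, E (s j) :=
        setIntegral_le_integral (integrable_finsetSum _ fun l _ => h_int l) (ae_of_all _ fun s =>
          Finset.sum_nonneg fun l _ => mul_nonneg (hφ_nonneg _) (hE_prod s))
    _ = d * (∫ t, E t) ^ (d - 1) * ∫ t, {t : ℝ | R < |t|}.indicator (fun t => |t| ^ i * E t) t := by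
        rw [integral_finsetSum _ fun l _ => h_int l, ← hφE]
        simp only [integral_mul_euclidean_prod, Finset.sum_const, Finset.card_univ,
          Fintype.card_fin, nsmul_eq_mul]
        ring

lemma setIntegral_compl_cube_prod_mul_exp_le (u : Fin i → Fin d) {α C : ℝ} (hα : 0 < α)
    (hC : 0 < C) (hR : 1 ≤ R) :
    ∫ s in (cube d R)ᶜ, (∏ k, |s (u k)|) * Real.exp (-(C * ∑ j, |s j| ^ α)) ≤
      d * (∫ t, Real.exp (-(C * |t| ^ α))) ^ (d - 1) *
        (2 * expTailConst C α i * (R ^ ((i : ℝ) + 1 - α) * Real.exp (-(C * R ^ α)))) := by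
  simp_rw [exp_neg_mul_sum_abs_rpow]
  refine (setIntegral_compl_cube_prod_le u (fun t => (Real.exp_pos _).le)
    (integrable_exp_neg_mul_abs_rpow hα hC) (integrable_abs_pow_mul_exp_neg hα hC i)).trans ?_
  gcongr
  exact integral_indicator_lt_abs_le hα hC hR i

end Cube

section MixtureDensity

variable {d : ℕ} {Θ : Set (EuclideanSpace ℝ (Fin d))} {f g : EuclideanSpace ℝ (Fin d) → ℝ}

lemma fourierHat_eq_re_of_even (hf : ∀ x, f (-x) = f x) (s : EuclideanSpace ℝ (Fin d)) :
    fourierHat f s = (fourierHat f s).re := by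
  have hconj : (starRingEnd ℂ) (fourierHat f s) = fourierHat f s := by
    rw [fourierHat, ← integral_conj, ← integral_neg_eq_self]
    refine integral_congr_ae (ae_of_all _ fun x => ?_)
    simp only [map_mul, Complex.conj_ofReal, hf, ← Complex.exp_conj, Complex.conj_I,
      inner_neg_right, Complex.ofReal_neg, neg_mul, mul_neg, neg_neg]
  exact (Complex.conj_eq_iff_re.mp hconj).symm

lemma mixtureDensity_nonneg (hf : ∀ x, 0 ≤ f x) (hg : ∀ x, 0 ≤ g x)
    (x : EuclideanSpace ℝ (Fin d)) : 0 ≤ mixtureDensity Θ f g x :=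
  integral_nonneg fun θ => mul_nonneg (hf _) (hg θ)

lemma mixtureDensity_eq_integral (hg : ∀ θ, θ ∉ Θ → g θ = 0) (x : EuclideanSpace ℝ (Fin d)) :
    mixtureDensity Θ f g x = ∫ θ, f (x - θ) * g θ :=
  setIntegral_eq_integral_of_forall_compl_eq_zero fun θ hθ => by rw [hg θ hθ, mul_zero]

lemma mixtureDensity_eq_convolution (hg : ∀ θ, θ ∉ Θ → g θ = 0) :
    mixtureDensity Θ f g = convolution g f (ContinuousLinearMap.mul ℝ ℝ) volume := by
  ext x
  simp only [mixtureDensity_eq_integral hg, convolution_def, ContinuousLinearMap.mul_apply',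
    mul_comm]

lemma ofReal_mixtureDensity_eq_convolution (hg : ∀ θ, θ ∉ Θ → g θ = 0)
    (x : EuclideanSpace ℝ (Fin d)) :
    (mixtureDensity Θ f g x : ℂ) =
      convolution (fun θ => (g θ : ℂ)) (fun θ => (f θ : ℂ)) (ContinuousLinearMap.mul ℂ ℂ)
        volume x := by
  rw [mixtureDensity_eq_integral hg, ← integral_complex_ofReal]
  simp only [convolution_def, ContinuousLinearMap.mul_apply', Complex.ofReal_mul, mul_comm]

lemma integrable_mixtureDensity (hf : Integrable f) (hg : Integrable g)
    (hgΘ : ∀ θ, θ ∉ Θ → g θ = 0) : Integrable (mixtureDensity Θ f g) := by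
  rw [mixtureDensity_eq_convolution hgΘ]
  exact hg.integrable_convolution _ hf

lemma fourierHat_mixtureDensity (hf : Integrable f) (hg : Integrable g)
    (hgΘ : ∀ θ, θ ∉ Θ → g θ = 0) (s : EuclideanSpace ℝ (Fin d)) :
    fourierHat (mixtureDensity Θ f g) s = fourierHat f s * fourierHat g s := by
  obtain ⟨t, rfl⟩ : ∃ t, s = (2 * π) • t :=
    ⟨(2 * π)⁻¹ • s, (smul_inv_smul₀ Real.two_pi_pos.ne' s).symm⟩
  simp_rw [fourierHat_two_pi_smul, ofReal_mixtureDensity_eq_convolution hgΘ]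
  rw [mul_comm]
  exact Real.fourier_mul_convolution_eq hg.ofReal hf.ofReal t

end MixtureDensity

section Expectation

variable {Ω : Type*} [MeasurableSpace Ω] {P : Measure Ω}

lemma integral_comp_of_map_eq_withDensity {E F : Type*} [MeasurableSpace E] {μ : Measure E}
    [NormedAddCommGroup F] [NormedSpace ℝ F] {X : Ω → E} {p : E → ℝ} (hX : AEMeasurable X P)
    (hlaw : P.map X = μ.withDensity fun x => ENNReal.ofReal (p x)) (hp : AEMeasurable p μ)
    (hp_nonneg : ∀ x, 0 ≤ p x) {φ : E → F} (hφ : StronglyMeasurable φ) :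
    ∫ ω, φ (X ω) ∂P = ∫ x, p x • φ x ∂μ := by
  rw [← integral_map hX hφ.aestronglyMeasurable, hlaw,
    integral_withDensity_eq_integral_toReal_smul₀ hp.ennreal_ofReal
      (ae_of_all _ fun _ => ENNReal.ofReal_lt_top)]
  simp only [ENNReal.toReal_ofReal (hp_nonneg _)]

variable {d : ℕ} {p : EuclideanSpace ℝ (Fin d) → ℝ} {w : EuclideanSpace ℝ (Fin d) → ℂ}

lemma integral_smul_trigIntegral_sub (hp : Integrable p) (hw : Integrable w)
    (θ : EuclideanSpace ℝ (Fin d)) :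
    ∫ x, p x • trigIntegral w (θ - x) = trigIntegral (fun s => w s * fourierHat p s) θ := by
  have h_int : Integrable (Function.uncurry fun x s : EuclideanSpace ℝ (Fin d) =>
      Complex.exp (Complex.I * (inner ℝ s (θ - x) : ℝ)) * (p x * w s))
      (volume.prod volume) := by
    refine (hp.ofReal.mul_prod hw).bdd_mul (c := 1)
      (Continuous.aestronglyMeasurable (by fun_prop)) (ae_of_all _ fun z => ?_)
    exact (Complex.norm_exp_I_mul_ofReal _).le
  calc ∫ x, p x • trigIntegral w (θ - x)
      = ∫ x, ∫ s, Complex.exp (Complex.I * (inner ℝ s (θ - x) : ℝ)) * (p x * w s) := by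
        simp only [trigIntegral, Complex.real_smul, ← integral_const_mul, mul_left_comm]
    _ = ∫ s, ∫ x, Complex.exp (Complex.I * (inner ℝ s (θ - x) : ℝ)) * (p x * w s) :=
        integral_integral_swap h_int
    _ = trigIntegral (fun s => w s * fourierHat p s) θ := by
        simp only [trigIntegral, fourierHat, ← integral_const_mul]
        refine integral_congr_ae (ae_of_all _ fun s => integral_congr_ae (ae_of_all _ fun x => ?_))
        simp only [inner_sub_right, Complex.ofReal_sub, mul_sub]
        rw [sub_eq_add_neg, Complex.exp_add]
        ring

lemma integral_reFourierInv_sub {X : Ω → EuclideanSpace ℝ (Fin d)} (hX : AEMeasurable X P)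
    (hlaw : P.map X = volume.withDensity fun x => ENNReal.ofReal (p x)) (hp : Integrable p)
    (hp_nonneg : ∀ x, 0 ≤ p x) (hw : Integrable w) (θ : EuclideanSpace ℝ (Fin d)) :
    ∫ ω, reFourierInv w (θ - X ω) ∂P = reFourierInv (fun s => w s * fourierHat p s) θ := by
  have hcont : Continuous fun x => trigIntegral w (θ - x) :=
    (continuous_trigIntegral hw).comp (continuous_const.sub continuous_id)
  have h_int : Integrable fun x => p x • trigIntegral w (θ - x) :=
    hp.smul_bdd _ hcont.aestronglyMeasurable (ae_of_all _ fun x => norm_trigIntegral_le w _)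
  have hre : ∫ ω, (trigIntegral w (θ - X ω)).re ∂P =
      (trigIntegral (fun s => w s * fourierHat p s) θ).re :=
    calc ∫ ω, (trigIntegral w (θ - X ω)).re ∂P = ∫ x, p x • (trigIntegral w (θ - x)).re :=
          integral_comp_of_map_eq_withDensity hX hlaw hp.1.aemeasurable hp_nonneg
            (Complex.continuous_re.comp hcont).stronglyMeasurable
      _ = (∫ x, p x • trigIntegral w (θ - x)).re := by
          simp only [← Complex.smul_re]
          exact integral_re h_int
      _ = (trigIntegral (fun s => w s * fourierHat p s) θ).re := by
          rw [integral_smul_trigIntegral_sub hp hw]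
  simp only [reFourierInv, integral_const_mul, hre]

end Expectation

section Estimator

variable {d : ℕ} {f : EuclideanSpace ℝ (Fin d) → ℝ} {R : ℝ}

lemma IsLowerSupersmooth.fourierHat_ne_zero {α c C : ℝ} (hf : IsLowerSupersmooth f α c C)
    (s : EuclideanSpace ℝ (Fin d)) : fourierHat f s ≠ 0 :=
  norm_pos_iff.mp ((mul_pos hf.const_pos (Real.exp_pos _)).trans_le (hf.bound s))

lemma IsLowerSupersmooth.norm_inv_fourierHat_le {α c C : ℝ} (hα : 0 ≤ α)
    (hf : IsLowerSupersmooth f α c C) {s : EuclideanSpace ℝ (Fin d)} (hs : s ∈ cube d R) :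
    ‖(fourierHat f s)⁻¹‖ ≤ c⁻¹ * Real.exp (C * d * R ^ α) := by
  have hc := hf.const_pos
  have hC := hf.rate_pos
  have hsum : ∑ j, |s j| ^ α ≤ d * R ^ α :=
    calc ∑ j, |s j| ^ α ≤ ∑ _j : Fin d, R ^ α :=
          Finset.sum_le_sum fun j _ => Real.rpow_le_rpow (abs_nonneg _) (abs_le.mpr (hs j)) hα
      _ = d * R ^ α := by
          rw [Finset.sum_const, Finset.card_univ, Fintype.card_fin, nsmul_eq_mul]
  calc ‖(fourierHat f s)⁻¹‖ ≤ (c * Real.exp (-(C * ∑ j, |s j| ^ α)))⁻¹ := by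
        rw [norm_inv]
        gcongr
        exact hf.bound s
    _ = c⁻¹ * Real.exp (C * ∑ j, |s j| ^ α) := by rw [mul_inv, Real.exp_neg, inv_inv]
    _ ≤ c⁻¹ * Real.exp (C * d * R ^ α) := by
        rw [mul_assoc]
        gcongr

/-- The truncated inverse `1_{[-R,R]^d} / f̂` of the Fourier transform of `f`. -/
noncomputable def deconvWeight (f : EuclideanSpace ℝ (Fin d) → ℝ) (R : ℝ) :
    EuclideanSpace ℝ (Fin d) → ℂ :=
  (cube d R).indicator fun s => (fourierHat f s)⁻¹

lemma hasMoments_deconvWeight (hf : Integrable f) (hf_ne : ∀ s, fourierHat f s ≠ 0) (R : ℝ)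
    (m : ℕ) : HasMoments (deconvWeight f R) m :=
  hasMoments_indicator_of_isCompact (isCompact_cube d R)
    ((continuous_fourierHat hf).inv₀ hf_ne).continuousOn m

lemma abs_reFourierInv_partialMultiplier_mul_deconvWeight_le {α c C : ℝ} (hα : 0 ≤ α) (hR : 0 ≤ R)
    (hf : IsLowerSupersmooth f α c C) {m : ℕ} (u : Fin m → Fin d)
    (y : EuclideanSpace ℝ (Fin d)) :
    |reFourierInv (fun s => partialMultiplier u s * deconvWeight f R s) y| ≤
      (π ^ d)⁻¹ * c⁻¹ * (R ^ (m + d) * Real.exp (C * d * R ^ α)) := by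
  have hc := hf.const_pos
  have hweight : (fun s => partialMultiplier u s * deconvWeight f R s) =
      (cube d R).indicator fun s => partialMultiplier u s * (fourierHat f s)⁻¹ :=
    funext fun s => (Set.indicator_mul_right _ _ _).symm
  have hbound : ∀ s ∈ cube d R, ‖partialMultiplier u s * (fourierHat f s)⁻¹‖ ≤
      R ^ m * (c⁻¹ * Real.exp (C * d * R ^ α)) := fun s hs => by
    rw [norm_mul, norm_partialMultiplier]
    exact mul_le_mul (prod_abs_apply_le u fun j => abs_le.mpr (hs j))
      (hf.norm_inv_fourierHat_le hα hs) (norm_nonneg _) (by positivity)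
  calc |reFourierInv (fun s => partialMultiplier u s * deconvWeight f R s) y|
      ≤ ((2 * π) ^ d)⁻¹ * (R ^ m * (c⁻¹ * Real.exp (C * d * R ^ α)) * (2 * R) ^ d) := by
        refine (abs_reFourierInv_le _ y).trans ?_
        rw [hweight, ← volume_real_cube d hR]
        gcongr
        exact norm_trigIntegral_indicator_le (measurableSet_cube d R)
          (isCompact_cube d R).measure_lt_top hbound y
    _ = (π ^ d)⁻¹ * c⁻¹ * (R ^ (m + d) * Real.exp (C * d * R ^ α)) := by
        rw [mul_pow, mul_pow, pow_add]
        field_simp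

lemma setIntegral_cube_cos_div (hf : ∀ x, f (-x) = f x) (hw : Integrable (deconvWeight f R))
    (y : EuclideanSpace ℝ (Fin d)) :
    ∫ s in cube d R, Real.cos (inner ℝ s y) / (fourierHat f s).re =
      (trigIntegral (deconvWeight f R) y).re := by
  have h_int : IntegrableOn (fun s => Complex.exp (Complex.I * (inner ℝ s y : ℝ)) *
      (fourierHat f s)⁻¹) (cube d R) := by
    rw [← integrable_indicator_iff (measurableSet_cube d R)]
    refine (integrable_exp_inner_mul hw y).congr (ae_of_all _ fun s => ?_)
    rw [Set.indicator_mul_right, deconvWeight]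
  rw [deconvWeight, trigIntegral_indicator (measurableSet_cube d R)]
  refine Eq.trans (integral_congr_ae (ae_of_all _ fun s => ?_)) (integral_re h_int)
  simp only
  rw [fourierHat_eq_re_of_even hf s, ← Complex.ofReal_inv, RCLike.re_eq_complex_re,
    Complex.re_mul_ofReal, mul_comm Complex.I, Complex.exp_ofReal_mul_I_re, Complex.ofReal_re,
    div_eq_mul_inv]

lemma deconvEstimator_eq_sum_reFourierInv (hf : ∀ x, f (-x) = f x)
    (hw : Integrable (deconvWeight f R)) {n : ℕ} (x : Fin n → EuclideanSpace ℝ (Fin d)) :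
    deconvEstimator f R x =
      (n : ℝ)⁻¹ • fun θ => ∑ j, reFourierInv (deconvWeight f R) (θ - x j) := by
  ext θ
  simp only [deconvEstimator, setIntegral_cube_cos_div hf hw, reFourierInv, Pi.smul_apply,
    smul_eq_mul, ← Finset.mul_sum]
  rw [one_div, mul_inv, mul_assoc]

variable {m n : ℕ}

lemma contDiff_deconvEstimator (hf : ∀ x, f (-x) = f x) (hw : HasMoments (deconvWeight f R) m)
    (x : Fin n → EuclideanSpace ℝ (Fin d)) : ContDiff ℝ m (deconvEstimator f R x) := by
  rw [deconvEstimator_eq_sum_reFourierInv hf hw.integrable]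
  exact contDiff_const.smul (ContDiff.sum fun j _ =>
    hw.contDiff_reFourierInv.comp (contDiff_id.sub contDiff_const))

lemma nabla_deconvEstimator_apply (hf : ∀ x, f (-x) = f x)
    (hw : HasMoments (deconvWeight f R) m) (x : Fin n → EuclideanSpace ℝ (Fin d))
    (θ : EuclideanSpace ℝ (Fin d)) (u : Fin m → Fin d) :
    nabla m (deconvEstimator f R x) θ u = (n : ℝ)⁻¹ *
      ∑ j, reFourierInv (fun s => partialMultiplier u s * deconvWeight f R s) (θ - x j) := by
  have hc : ∀ j, ContDiff ℝ m fun θ => reFourierInv (deconvWeight f R) (θ - x j) := fun j =>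
    hw.contDiff_reFourierInv.comp (contDiff_id.sub contDiff_const)
  simp only [← hw.nabla_reFourierInv_apply, nabla, ← iteratedFDeriv_comp_sub]
  rw [deconvEstimator_eq_sum_reFourierInv hf hw.integrable,
    iteratedFDeriv_const_smul_apply (ContDiff.sum fun j _ => hc j).contDiffAt,
    iteratedFDeriv_fun_sum_apply fun j _ => (hc j).contDiffAt]
  simp only [smul_apply, sum_apply, smul_eq_mul]

end Estimator

section MixingDensity

lemma eqOn_of_ae_eq_of_nhds_measure_ne_zero {X Y : Type*} [TopologicalSpace X]
    [MeasurableSpace X] [TopologicalSpace Y] [T2Space Y] {μ : Measure X} {S : Set X}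
    (hS : ∀ x ∈ S, ∀ U ∈ 𝓝 x, μ (U ∩ S) ≠ 0) {g k : X → Y} (hg : ContinuousOn g S)
    (hk : ContinuousOn k S) (h : g =ᵐ[μ] k) : Set.EqOn g k S := by
  intro x hx
  by_contra hne
  have hmem : {y | g y ≠ k y} ∈ 𝓝[S] x :=
    ((hg x hx).prodMk_nhds (hk x hx)).eventually (isClosed_diagonal.isOpen_compl.mem_nhds hne)
  obtain ⟨U, hU, hUS⟩ := mem_nhdsWithin_iff_exists_mem_nhds_inter.mp hmem
  exact hS x hx U hU (measure_mono_null hUS h)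

variable {d m : ℕ} {Θ : Set (EuclideanSpace ℝ (Fin d))} {f g : EuclideanSpace ℝ (Fin d) → ℝ}
  {α C C₁ R : ℝ}

lemma IsUpperSupersmooth.hasMoments_fourierHat (hα : 0 < α) (hg : Integrable g)
    (hup : IsUpperSupersmooth g α C C₁) (m : ℕ) : HasMoments (fourierHat g) m where
  aestronglyMeasurable := (continuous_fourierHat hg).aestronglyMeasurable
  integrable_norm_pow_mul k _ := by
    refine ((integrable_norm_pow_mul_exp_neg hα hup.rate_pos k).const_mul C).mono'
      ((continuous_norm.pow k).mul (continuous_fourierHat hg).norm).aestronglyMeasurable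
      (ae_of_all _ fun s => ?_)
    rw [Real.norm_of_nonneg (by positivity), mul_left_comm]
    gcongr
    exact hup.bound s

lemma nablaWithin_apply_eq_reFourierInv_fourierHat (hΘ : UniqueDiffOn ℝ Θ)
    (hΘ_vol : ∀ θ ∈ Θ, ∀ U ∈ 𝓝 θ, volume (U ∩ Θ) ≠ 0) (hg : Integrable g)
    (hg_cont : ContinuousOn g Θ) (hm : HasMoments (fourierHat g) m)
    {θ : EuclideanSpace ℝ (Fin d)} (hθ : θ ∈ Θ) (u : Fin m → Fin d) :
    nablaWithin m Θ g θ u = reFourierInv (fun s => partialMultiplier u s * fourierHat g s) θ := by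
  have heqOn : Set.EqOn g (reFourierInv (fourierHat g)) Θ :=
    eqOn_of_ae_eq_of_nhds_measure_ne_zero hΘ_vol hg_cont
      (continuous_reFourierInv hm.integrable).continuousOn
      (ae_eq_reFourierInv_fourierHat hg hm.integrable)
  rw [← hm.nabla_reFourierInv_apply, nablaWithin, nabla, iteratedFDerivWithin_congr heqOn hθ,
    iteratedFDerivWithin_eq_iteratedFDeriv hΘ hm.contDiff_reFourierInv.contDiffAt hθ]

/-- The constant in the bound for the bias of the derivatives of order `i`: the constant of the
Fourier inversion formula times that of the tail integral of the Fourier transform outside the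
cube. -/
noncomputable def deconvBiasConst (d : ℕ) (α C C₁ : ℝ) (i : ℕ) : ℝ :=
  ((2 * π) ^ d)⁻¹ * (C * (d * (∫ t : ℝ, Real.exp (-(C₁ * |t| ^ α))) ^ (d - 1) *
    (2 * expTailConst C₁ α i)))

lemma deconvBiasConst_nonneg (d : ℕ) (hα : 0 < α) (hC : 0 ≤ C) (C₁ : ℝ) (i : ℕ) :
    0 ≤ deconvBiasConst d α C C₁ i := by
  have htail := expTailConst_nonneg hα C₁ i
  unfold deconvBiasConst
  positivity

lemma abs_reFourierInv_indicator_cube_sub_le (hα : 0 < α) (hg : Integrable g)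
    (hup : IsUpperSupersmooth g α C C₁) (hR : 1 ≤ R) (u : Fin m → Fin d)
    (θ : EuclideanSpace ℝ (Fin d)) :
    |reFourierInv ((cube d R).indicator fun s => partialMultiplier u s * fourierHat g s) θ -
        reFourierInv (fun s => partialMultiplier u s * fourierHat g s) θ| ≤
      deconvBiasConst d α C C₁ m * (R ^ ((m : ℝ) + 1 - α) * Real.exp (-(C₁ * R ^ α))) := by
  have hC := hup.const_pos
  have h_int := (hup.hasMoments_fourierHat hα hg m).integrable_partialMultiplier_mul u
  have htail : ∫ s in (cube d R)ᶜ, ‖partialMultiplier u s * fourierHat g s‖ ≤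
      C * ∫ s in (cube d R)ᶜ, (∏ k, |s (u k)|) * Real.exp (-(C₁ * ∑ j, |s j| ^ α)) := by
    rw [← integral_const_mul]
    refine integral_mono h_int.norm.integrableOn
      ((integrable_prod_abs_mul_exp_neg u hα hup.rate_pos).const_mul C).integrableOn fun s => ?_
    simp only
    rw [norm_mul, norm_partialMultiplier, mul_left_comm]
    gcongr
    exact hup.bound s
  calc _ ≤ ((2 * π) ^ d)⁻¹ * ∫ s in (cube d R)ᶜ, ‖partialMultiplier u s * fourierHat g s‖ := by
        refine (abs_reFourierInv_sub_le _ _ θ).trans ?_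
        gcongr
        exact norm_trigIntegral_indicator_sub_le (measurableSet_cube d R) h_int θ
    _ ≤ ((2 * π) ^ d)⁻¹ * (C * (d * (∫ t : ℝ, Real.exp (-(C₁ * |t| ^ α))) ^ (d - 1) *
          (2 * expTailConst C₁ α m * (R ^ ((m : ℝ) + 1 - α) * Real.exp (-(C₁ * R ^ α)))))) := by
        gcongr
        exact htail.trans (by
          gcongr
          exact setIntegral_compl_cube_prod_mul_exp_le u hα hup.rate_pos hR)
    _ = _ := by
        rw [deconvBiasConst]
        ring

lemma partialMultiplier_mul_deconvWeight_mul_fourierHat (hf : Integrable f)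
    (hf_ne : ∀ s, fourierHat f s ≠ 0) (hg : Integrable g) (hgΘ : ∀ θ, θ ∉ Θ → g θ = 0)
    (u : Fin m → Fin d) (s : EuclideanSpace ℝ (Fin d)) :
    partialMultiplier u s * deconvWeight f R s * fourierHat (mixtureDensity Θ f g) s =
      (cube d R).indicator (fun s => partialMultiplier u s * fourierHat g s) s := by
  by_cases hs : s ∈ cube d R
  · rw [deconvWeight, Set.indicator_of_mem hs, Set.indicator_of_mem hs,
      fourierHat_mixtureDensity hf hg hgΘ, mul_assoc, inv_mul_cancel_left₀ (hf_ne s)]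
  · rw [deconvWeight, Set.indicator_of_notMem hs, Set.indicator_of_notMem hs, mul_zero, zero_mul]

end MixingDensity

section SampleMean

variable {Ω E : Type*} [MeasurableSpace Ω] {P : Measure Ω} [MeasurableSpace E] {n : ℕ}
  {X : Fin n → Ω → E} {φ : E → ℝ} {M : ℝ}

lemma memLp_comp_of_abs_le [IsFiniteMeasure P] {Y : Ω → E} (hY : AEMeasurable Y P)
    (hφ : Measurable φ) (hM : ∀ x, |φ x| ≤ M) (q : ENNReal) : MemLp (fun ω => φ (Y ω)) q P :=
  MemLp.of_bound (hφ.comp_aemeasurable hY).aestronglyMeasurable M (ae_of_all _ fun _ => hM _)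

lemma memLp_sampleMean [IsFiniteMeasure P] (hX : ∀ j, AEMeasurable (X j) P) (hφ : Measurable φ)
    (hM : ∀ x, |φ x| ≤ M) (q : ENNReal) : MemLp (fun ω => (n : ℝ)⁻¹ * ∑ j, φ (X j ω)) q P := by
  have hsum : MemLp (fun ω => ∑ j, φ (X j ω)) q P :=
    memLp_finsetSum _ fun j _ => memLp_comp_of_abs_le (hX j) hφ hM q
  exact hsum.const_mul _

lemma integral_sampleMean [IsFiniteMeasure P] (hn : n ≠ 0) (hX : ∀ j, AEMeasurable (X j) P)
    (hφ : Measurable φ) (hM : ∀ x, |φ x| ≤ M) {a : ℝ} (ha : ∀ j, ∫ ω, φ (X j ω) ∂P = a) :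
    ∫ ω, (n : ℝ)⁻¹ * ∑ j, φ (X j ω) ∂P = a := by
  rw [integral_const_mul, integral_finsetSum _ fun j _ =>
    (memLp_comp_of_abs_le (hX j) hφ hM 1).integrable le_rfl]
  simp only [ha, Finset.sum_const, Finset.card_univ, Fintype.card_fin, nsmul_eq_mul]
  exact inv_mul_cancel_left₀ (Nat.cast_ne_zero.mpr hn) a

lemma variance_sampleMean_le [IsProbabilityMeasure P] (hX : ∀ j, AEMeasurable (X j) P)
    (hindep : iIndepFun X P) (hφ : Measurable φ) (hM : ∀ x, |φ x| ≤ M) :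
    Var[fun ω => (n : ℝ)⁻¹ * ∑ j, φ (X j ω); P] ≤ M ^ 2 / n := by
  have hvar : ∀ j, Var[fun ω => φ (X j ω); P] ≤ M ^ 2 := fun j => by
    refine (variance_le_sq_of_bounded (a := -M) (b := M) (ae_of_all _ fun ω => abs_le.mp (hM _))
      (hφ.comp_aemeasurable (hX j))).trans_eq ?_
    ring
  have hsum : (fun ω => ∑ j, φ (X j ω)) = ∑ j, fun ω => φ (X j ω) :=
    funext fun ω => by rw [Finset.sum_apply]
  rw [variance_const_mul, hsum, IndepFun.variance_sum
    (fun j _ => memLp_comp_of_abs_le (hX j) hφ hM 2)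
    fun i _ j _ hij => (hindep.indepFun hij).comp hφ hφ]
  calc (n : ℝ)⁻¹ ^ 2 * ∑ j, Var[fun ω => φ (X j ω); P] ≤ (n : ℝ)⁻¹ ^ 2 * ∑ _j : Fin n, M ^ 2 := by
        gcongr with j
        exact hvar j
    _ = M ^ 2 / n := by
        rw [Finset.sum_const, Finset.card_univ, Fintype.card_fin, nsmul_eq_mul]
        field_simp

end SampleMean

section EuclideanVectors

variable {Ω ι : Type*} [MeasurableSpace Ω] {P : Measure Ω} [Fintype ι]
  {Y : Ω → EuclideanSpace ℝ ι}

lemma norm_sq_sub_integral_eq_sum (hY : ∀ u, Integrable (fun ω => Y ω u) P) (ω : Ω) :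
    ‖Y ω - ∫ ω', Y ω' ∂P‖ ^ 2 = ∑ u, (Y ω u - ∫ ω', Y ω' u ∂P) ^ 2 := by
  rw [EuclideanSpace.norm_sq_eq]
  refine Finset.sum_congr rfl fun u _ => ?_
  rw [PiLp.sub_apply, eval_integral_piLp hY, Real.norm_eq_abs, sq_abs]

variable [IsFiniteMeasure P]

lemma integrable_norm_sq_sub_integral (hY : ∀ u, MemLp (fun ω => Y ω u) 2 P) :
    Integrable (fun ω => ‖Y ω - ∫ ω', Y ω' ∂P‖ ^ 2) P := by
  simp_rw [norm_sq_sub_integral_eq_sum fun u => (hY u).integrable one_le_two]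
  exact integrable_finsetSum _ fun u _ => ((hY u).sub (memLp_const _)).integrable_sq

lemma integral_norm_sq_sub_integral_eq_sum_variance (hY : ∀ u, MemLp (fun ω => Y ω u) 2 P) :
    ∫ ω, ‖Y ω - ∫ ω', Y ω' ∂P‖ ^ 2 ∂P = ∑ u, Var[fun ω => Y ω u; P] := by
  simp_rw [norm_sq_sub_integral_eq_sum fun u => (hY u).integrable one_le_two]
  have h_int : ∀ u, Integrable (fun ω => (Y ω u - ∫ ω', Y ω' u ∂P) ^ 2) P :=
    fun u => ((hY u).sub (memLp_const _)).integrable_sq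
  rw [integral_finsetSum _ fun u _ => h_int u]
  exact Finset.sum_congr rfl fun u _ => (variance_eq_integral (hY u).1.aemeasurable).symm

lemma maxNorm_le {T : EuclideanSpace ℝ ι} {b : ℝ} (hb : 0 ≤ b) (hT : ∀ u, |T u| ≤ b) :
    maxNorm T ≤ b :=
  Real.iSup_le hT hb

end EuclideanVectors

section Deconvolution

variable {d n m : ℕ} {Θ : Set (EuclideanSpace ℝ (Fin d))} {f g : EuclideanSpace ℝ (Fin d) → ℝ}
  {Ω : Type*} [MeasurableSpace Ω] {P : Measure Ω} {X : Fin n → Ω → EuclideanSpace ℝ (Fin d)}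
  {R α₁ α₂ c C C₁ C₂ : ℝ}

lemma measurable_reFourierInv_partialMultiplier_mul_deconvWeight
    (hw : HasMoments (deconvWeight f R) m) (u : Fin m → Fin d) (θ : EuclideanSpace ℝ (Fin d)) :
    Measurable fun x =>
      reFourierInv (fun s => partialMultiplier u s * deconvWeight f R s) (θ - x) :=
  ((continuous_reFourierInv (hw.integrable_partialMultiplier_mul u)).comp
    (continuous_const.sub continuous_id)).measurable

lemma memLp_nabla_deconvEstimator_apply [IsFiniteMeasure P] (hX : ∀ j, AEMeasurable (X j) P)
    (hf_even : ∀ x, f (-x) = f x) (hw : HasMoments (deconvWeight f R) m)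
    (θ : EuclideanSpace ℝ (Fin d)) (u : Fin m → Fin d) :
    MemLp (fun ω => nabla m (deconvEstimator f R fun j => X j ω) θ u) 2 P := by
  simp_rw [nabla_deconvEstimator_apply hf_even hw]
  exact memLp_sampleMean hX (measurable_reFourierInv_partialMultiplier_mul_deconvWeight hw u θ)
    (fun _ => abs_reFourierInv_le_integral_norm _ _) 2

lemma integral_nabla_deconvEstimator_apply [IsFiniteMeasure P] (hn : n ≠ 0)
    (hX : IsIIDSample P X (mixtureDensity Θ f g)) (hf : IsDensity f)
    (hf_even : ∀ x, f (-x) = f x) (hf_ne : ∀ s, fourierHat f s ≠ 0) (hg : IsDensity g)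
    (hgΘ : ∀ θ, θ ∉ Θ → g θ = 0) (θ : EuclideanSpace ℝ (Fin d)) (u : Fin m → Fin d) :
    ∫ ω, nabla m (deconvEstimator f R fun j => X j ω) θ u ∂P =
      reFourierInv ((cube d R).indicator fun s => partialMultiplier u s * fourierHat g s) θ := by
  have hw := hasMoments_deconvWeight hf.integrable hf_ne R m
  simp_rw [nabla_deconvEstimator_apply hf_even hw]
  refine integral_sampleMean hn hX.aemeasurable
    (measurable_reFourierInv_partialMultiplier_mul_deconvWeight hw u θ)
    (fun _ => abs_reFourierInv_le_integral_norm _ _) fun j => ?_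
  rw [integral_reFourierInv_sub (hX.aemeasurable j) (hX.law j)
    (integrable_mixtureDensity hf.integrable hg.integrable hgΘ)
    (mixtureDensity_nonneg hf.nonneg hg.nonneg) (hw.integrable_partialMultiplier_mul u)]
  congr 1
  exact funext fun s => partialMultiplier_mul_deconvWeight_mul_fourierHat hf.integrable hf_ne
    hg.integrable hgΘ u s

lemma maxNorm_integral_nabla_deconvEstimator_sub_le [IsFiniteMeasure P] (hα₂ : 0 < α₂)
    (hR : 1 ≤ R) (hn : n ≠ 0) (hX : IsIIDSample P X (mixtureDensity Θ f g)) (hf : IsDensity f)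
    (hf_even : ∀ x, f (-x) = f x) (hf_ne : ∀ s, fourierHat f s ≠ 0) (hg : IsDensity g)
    (hgΘ : ∀ θ, θ ∉ Θ → g θ = 0) (hup : IsUpperSupersmooth g α₂ C C₁)
    (hg_cont : ContinuousOn g Θ) (hΘ : UniqueDiffOn ℝ Θ)
    (hΘ_vol : ∀ θ ∈ Θ, ∀ U ∈ 𝓝 θ, volume (U ∩ Θ) ≠ 0) {θ : EuclideanSpace ℝ (Fin d)}
    (hθ : θ ∈ Θ) :
    maxNorm ((∫ ω, nabla m (deconvEstimator f R fun j => X j ω) θ ∂P) - nablaWithin m Θ g θ) ≤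
      deconvBiasConst d α₂ C C₁ m * (R ^ ((m : ℝ) + 1 - α₂) * Real.exp (-(C₁ * R ^ α₂))) := by
  have hw := hasMoments_deconvWeight hf.integrable hf_ne R m
  have hK := deconvBiasConst_nonneg d hα₂ hup.const_pos.le C₁ m
  have h_int := fun u => (memLp_nabla_deconvEstimator_apply hX.aemeasurable hf_even hw θ
    u).integrable one_le_two
  refine maxNorm_le (by positivity) fun u => ?_
  rw [PiLp.sub_apply, eval_integral_piLp h_int,
    integral_nabla_deconvEstimator_apply hn hX hf hf_even hf_ne hg hgΘ,
    nablaWithin_apply_eq_reFourierInv_fourierHat hΘ hΘ_vol hg.integrable hg_cont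
      (hup.hasMoments_fourierHat hα₂ hg.integrable m) hθ]
  exact abs_reFourierInv_indicator_cube_sub_le hα₂ hg.integrable hup hR u θ

/-- The constant in the bound for the variance of the derivatives of order `i`: there are `d ^ i`
of them, and the rest bounds the square of the kernel of the estimator. -/
noncomputable def deconvVarianceConst (d : ℕ) (c : ℝ) (i : ℕ) : ℝ :=
  d ^ i * ((π ^ d)⁻¹ * c⁻¹) ^ 2

lemma variance_nabla_deconvEstimator_apply_le [IsProbabilityMeasure P] (hα₁ : 0 ≤ α₁) (hR : 0 ≤ R)
    (hX : ∀ j, AEMeasurable (X j) P) (hindep : iIndepFun X P) (hf : Integrable f)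
    (hf_even : ∀ x, f (-x) = f x) (hlow : IsLowerSupersmooth f α₁ c C₂)
    (θ : EuclideanSpace ℝ (Fin d)) (u : Fin m → Fin d) :
    Var[fun ω => nabla m (deconvEstimator f R fun j => X j ω) θ u; P] ≤
      ((π ^ d)⁻¹ * c⁻¹) ^ 2 * (R ^ (2 * (m + d)) * Real.exp (2 * C₂ * d * R ^ α₁) / n) := by
  have hw := hasMoments_deconvWeight hf hlow.fourierHat_ne_zero R m
  simp_rw [nabla_deconvEstimator_apply hf_even hw]
  refine (variance_sampleMean_le hX hindep
    (measurable_reFourierInv_partialMultiplier_mul_deconvWeight hw u θ)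
    fun x => abs_reFourierInv_partialMultiplier_mul_deconvWeight_le hα₁ hR hlow u _).trans_eq ?_
  have hexp : Real.exp (2 * C₂ * d * R ^ α₁) = Real.exp (C₂ * d * R ^ α₁) ^ 2 := by
    rw [← Real.exp_nat_mul]
    congr 1
    push_cast
    ring
  rw [hexp]
  ring

lemma integral_norm_sq_nabla_deconvEstimator_sub_le [IsProbabilityMeasure P] (hα₁ : 0 ≤ α₁)
    (hR : 0 ≤ R) (hX : ∀ j, AEMeasurable (X j) P) (hindep : iIndepFun X P) (hf : Integrable f)
    (hf_even : ∀ x, f (-x) = f x) (hlow : IsLowerSupersmooth f α₁ c C₂)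
    (θ : EuclideanSpace ℝ (Fin d)) :
    ∫ ω, ‖nabla m (deconvEstimator f R fun j => X j ω) θ -
        ∫ ω', nabla m (deconvEstimator f R fun j => X j ω') θ ∂P‖ ^ 2 ∂P ≤
      deconvVarianceConst d c m *
        (R ^ (2 * (m + d)) * Real.exp (2 * C₂ * d * R ^ α₁) / n) := by
  rw [integral_norm_sq_sub_integral_eq_sum_variance
    (memLp_nabla_deconvEstimator_apply hX hf_even
      (hasMoments_deconvWeight hf hlow.fourierHat_ne_zero R m) θ)]
  refine (Finset.sum_le_card_nsmul _ _ _ fun u _ =>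
    variance_nabla_deconvEstimator_apply_le hα₁ hR hX hindep hf hf_even hlow θ u).trans_eq ?_
  simp only [Finset.card_univ, Fintype.card_fun, Fintype.card_fin, nsmul_eq_mul,
    deconvVarianceConst, Nat.cast_pow, mul_assoc]

theorem theorem7_general [IsProbabilityMeasure P] (hα₁ : 0 ≤ α₁) (hα₂ : 0 < α₂)
    (hΘ : UniqueDiffOn ℝ Θ) (hΘ_vol : ∀ θ ∈ Θ, ∀ U ∈ 𝓝 θ, volume (U ∩ Θ) ≠ 0)
    (hf : IsDensity f) (hf_even : ∀ x, f (-x) = f x) (hlow : IsLowerSupersmooth f α₁ c C₂)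
    (hg : IsDensity g) (hgΘ : ∀ θ, θ ∉ Θ → g θ = 0) (hup : IsUpperSupersmooth g α₂ C C₁)
    (hg_cont : ContinuousOn g Θ) (hn : n ≠ 0) (hX : IsIIDSample P X (mixtureDensity Θ f g))
    (hR : 1 ≤ R) (i : ℕ) :
    (∀ ω, ContDiff ℝ (i : ℕ∞) (deconvEstimator f R fun j => X j ω)) ∧
    ∀ θ ∈ Θ,
      Integrable (fun ω => nabla i (deconvEstimator f R fun j => X j ω) θ) P ∧
      maxNorm ((∫ ω, nabla i (deconvEstimator f R fun j => X j ω) θ ∂P) - nablaWithin i Θ g θ) ≤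
        deconvBiasConst d α₂ C C₁ i * R ^ max ((i : ℝ) + 1 - α₂) 0 *
          Real.exp (-(C₁ * R ^ α₂)) ∧
      Integrable (fun ω => ‖nabla i (deconvEstimator f R fun j => X j ω) θ -
        ∫ ω', nabla i (deconvEstimator f R fun j => X j ω') θ ∂P‖ ^ 2) P ∧
      ∫ ω, ‖nabla i (deconvEstimator f R fun j => X j ω) θ -
          ∫ ω', nabla i (deconvEstimator f R fun j => X j ω') θ ∂P‖ ^ 2 ∂P ≤
        deconvVarianceConst d c i *
          (R ^ (2 * (i + d)) * Real.exp (2 * C₂ * d * R ^ α₁) / n) := by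
  have hf_ne := hlow.fourierHat_ne_zero
  have hw := hasMoments_deconvWeight hf.integrable hf_ne R i
  refine ⟨fun ω => contDiff_deconvEstimator hf_even hw _, fun θ hθ => ?_⟩
  have hmem := memLp_nabla_deconvEstimator_apply hX.aemeasurable hf_even hw θ
  have hbias := maxNorm_integral_nabla_deconvEstimator_sub_le (m := i) hα₂ hR hn hX hf hf_even
    hf_ne hg hgΘ hup hg_cont hΘ hΘ_vol hθ
  have hK := deconvBiasConst_nonneg d hα₂ hup.const_pos.le C₁ i
  refine ⟨.of_eval_piLp fun u => (hmem u).integrable one_le_two, hbias.trans ?_,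
    integrable_norm_sq_sub_integral hmem,
    integral_norm_sq_nabla_deconvEstimator_sub_le hα₁ (zero_le_one.trans hR) hX.aemeasurable
      hX.indep hf.integrable hf_even hlow θ⟩
  rw [← mul_assoc]
  gcongr
  exact le_max_left _ _

end Deconvolution

theorem theorem7 (d r : ℕ) (α₁ α₂ C C₁ c C₂ : ℝ) (hα₁ : 0 < α₁) (hα : α₁ ≤ α₂) :
    ∃ (C' : ℝ) (K L : ℕ → ℝ), 0 < C' ∧
      ∀ (Θ : Set (EuclideanSpace ℝ (Fin d))) (f g : EuclideanSpace ℝ (Fin d) → ℝ),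
        IsParameterSet Θ →
        IsDensity f → (∀ x, f (-x) = f x) → IsLowerSupersmooth f α₁ c C₂ →
        IsDensity g → (∀ θ, θ ∉ Θ → g θ = 0) → IsUpperSupersmooth g α₂ C C₁ →
        eLpNorm g ⊤ volume < ⊤ → IsBoundedIntegrableCr r Θ g →
        ∀ (n : ℕ), 1 ≤ n →
        ∀ (Ω : Type*) [MeasurableSpace Ω] (P : Measure Ω) [IsProbabilityMeasure P]
          (X : Fin n → Ω → EuclideanSpace ℝ (Fin d)),
        IsIIDSample P X (mixtureDensity Θ f g) →
        ∀ R : ℝ, C' ≤ R → ∀ i : ℕ, 1 ≤ i → i ≤ r →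
          (∀ ω, ContDiff ℝ (i : ℕ∞) (deconvEstimator f R fun j => X j ω)) ∧
          ∀ θ ∈ Θ,
            Integrable (fun ω => nabla i (deconvEstimator f R fun j => X j ω) θ) P ∧
            maxNorm ((∫ ω, nabla i (deconvEstimator f R fun j => X j ω) θ ∂P)
                - nablaWithin i Θ g θ)
              ≤ K i * R ^ max ((i : ℝ) + 1 - α₂) 0 * Real.exp (-(C₁ * R ^ α₂)) ∧
            Integrable (fun ω => ‖nabla i (deconvEstimator f R fun j => X j ω) θ
              - ∫ ω', nabla i (deconvEstimator f R fun j => X j ω') θ ∂P‖ ^ 2) P ∧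
            ∫ ω, ‖nabla i (deconvEstimator f R fun j => X j ω) θ
                - ∫ ω', nabla i (deconvEstimator f R fun j => X j ω') θ ∂P‖ ^ 2 ∂P
              ≤ L i * (R ^ (2 * (i + d)) * Real.exp (2 * C₂ * d * R ^ α₁) / n) := by
  refine ⟨1, deconvBiasConst d α₂ C C₁, deconvVarianceConst d c, one_pos, ?_⟩
  intro Θ f g hΘ hf hf_even hlow hg hgΘ hup _ hgr n hn Ω _ P _ X hX R hR i _ _
  exact theorem7_general hα₁.le (hα₁.trans_le hα) hΘ.uniqueDiffOn hΘ.volume_ne_zero hf hf_even hlow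
    hg hgΘ hup hgr.contDiffOn.continuousOn (Nat.one_le_iff_ne_zero.mp hn) hX hR i
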